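/- Let $K$ be a field of characteristic different from $2$, let $t,k\ge 0$ be integers with $k\ge t$, and let $\alpha_1,\dots,\alpha_t\in K$ be nonzero. Let $A=K\{\alpha_1,\dots,\alpha_t\}$ be the $2^t$-dimensional algebra obtained from $K$ (with the identity as involution) by applying the Cayley–Dickson process $t$ times, with parameters $\alpha_1,\dots,\alpha_t$ in this order. Here the algebra $(B,\gamma)$ obtained from an algebra $B$ with scalar involution $x\mapsto\bar x$ and $\gamma\in K\setminus\{0\}$ is $B\oplus B$ with product $$(a_1,a_2)(b_1,b_2)=(a_1b_1+\gamma\,\overline{b_2}\,a_2,\; a_2\overline{b_1}+b_2a_1)$$ and involution $\overline{(a_1,a_2)}=(\overline{a_1},-a_2)$. Write $x+\bar x=t(x)\cdot 1$ with $t(x)\in K$, let $T_C(x)=\tfrac12\,t(x^2)$ be the trace form of $A$, and let the pure trace form $T_P$ be the restriction of $T_C$ to $A_0=\{x\in A: t(x)=0\}$. The level $s(A)$ is the least integer $n$ such that $-1$ is a sum of $n$ squares in $A$, and $s(A)=\infty$ if there is no such $n$. Then $$s(A)\le 2^k\quad\Longleftrightarrow\quad (2^k+1)\times\langle 1\rangle\;\perp\;(2^k-1)\times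 T_P\ \text{ is isotropic over } K,$$ where $m\times q$ denotes the orthogonal sum of $m$ copies of the form $q$, and a form is isotropic if it vanishes at some nonzero vector. -/

import Mathlib

universe u

/-- A unitary, not necessarily associative, algebra over `K` with a scalar involution:
a `K`-linear map `conj` of order two reversing products, such that `a + conj a` and `a * conj a`
are scalar multiples `tr a • 1` and `nrm a • 1` of the identity. -/
structure ScalarInvAlgebra (K : Type u) [Field K] where
  carrier : Type u
  [ring : NonAssocRing carrier]
  [nontrivial : Nontrivial carrier]
  [module : Module K carrier]
  [isScalarTower : IsScalarTower K carrier carrier]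
  [smulCommClass : SMulCommClass K carrier carrier]
  [finite : Module.Finite K carrier]
  conj : carrier →ₗ[K] carrier
  tr : carrier →ₗ[K] K
  nrm : carrier → K
  conj_conj : ∀ a, conj (conj a) = a
  conj_mul : ∀ a b, conj (a * b) = conj b * conj a
  add_conj : ∀ a, a + conj a = tr a • (1 : carrier)
  mul_conj : ∀ a, a * conj a = nrm a • (1 : carrier)

namespace ScalarInvAlgebra

attribute [instance] ring nontrivial module isScalarTower smulCommClass finite

variable {K : Type u} [Field K]

theorem conj_eq (A : ScalarInvAlgebra K) (a : A.carrier) :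
    A.conj a = A.tr a • (1 : A.carrier) - a := by
  rw [← A.add_conj a]; abel

theorem conj_mul_self (A : ScalarInvAlgebra K) (a : A.carrier) :
    A.conj a * a = A.nrm a • (1 : A.carrier) := by
  rw [← A.mul_conj a, A.conj_eq a]
  simp [sub_mul, mul_sub]

theorem conj_one (A : ScalarInvAlgebra K) : A.conj 1 = 1 := by
  have h := A.conj_mul 1 (A.conj 1)
  simpa [A.conj_conj] using h.symm

/-- The field `K` as an algebra over itself, with the identity as scalar involution. -/
def base (K : Type u) [Field K] : ScalarInvAlgebra K where
  carrier := K
  conj := LinearMap.id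
  tr := (2 : K) • LinearMap.id
  nrm a := a * a
  conj_conj _ := rfl
  conj_mul a b := mul_comm a b
  add_conj a := by simp [two_mul]
  mul_conj a := by simp

/-- The underlying vector space `A ⊕ A` of the Cayley–Dickson double `(A, γ)`. -/
def Double (A : ScalarInvAlgebra K) (_γ : K) : Type u := A.carrier × A.carrier

namespace Double

variable {A : ScalarInvAlgebra K} {γ : K}

instance : AddCommGroup (Double A γ) := inferInstanceAs (AddCommGroup (A.carrier × A.carrier))
instance : Module K (Double A γ) := inferInstanceAs (Module K (A.carrier × A.carrier))
instance : Nontrivial (Double A γ) := inferInstanceAs (Nontrivial (A.carrier × A.carrier))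
instance : Module.Finite K (Double A γ) :=
  inferInstanceAs (Module.Finite K (A.carrier × A.carrier))

@[ext] theorem ext {x y : Double A γ} (h₁ : x.1 = y.1) (h₂ : x.2 = y.2) : x = y :=
  Prod.ext h₁ h₂

/-- The Cayley–Dickson product
`(a₁, a₂) (b₁, b₂) = (a₁ b₁ + γ (conj b₂) a₂, a₂ (conj b₁) + b₂ a₁)`. -/
instance : Mul (Double A γ) :=
  ⟨fun a b => (a.1 * b.1 + γ • (A.conj b.2 * a.2), a.2 * A.conj b.1 + b.2 * a.1)⟩

instance : One (Double A γ) := ⟨((1 : A.carrier), (0 : A.carrier))⟩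

@[simp] theorem add_fst (x y : Double A γ) : (x + y).1 = x.1 + y.1 := rfl
@[simp] theorem add_snd (x y : Double A γ) : (x + y).2 = x.2 + y.2 := rfl
@[simp] theorem zero_fst : (0 : Double A γ).1 = 0 := rfl
@[simp] theorem zero_snd : (0 : Double A γ).2 = 0 := rfl
@[simp] theorem one_fst : (1 : Double A γ).1 = 1 := rfl
@[simp] theorem one_snd : (1 : Double A γ).2 = 0 := rfl
@[simp] theorem smul_fst (c : K) (x : Double A γ) : (c • x).1 = c • x.1 := rfl
@[simp] theorem smul_snd (c : K) (x : Double A γ) : (c • x).2 = c • x.2 := rfl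
@[simp] theorem mul_fst (x y : Double A γ) :
    (x * y).1 = x.1 * y.1 + γ • (A.conj y.2 * x.2) := rfl
@[simp] theorem mul_snd (x y : Double A γ) :
    (x * y).2 = x.2 * A.conj y.1 + y.2 * x.1 := rfl

instance : NonAssocRing (Double A γ) :=
  { (inferInstance : AddCommGroup (Double A γ)),
    (inferInstance : Mul (Double A γ)), (inferInstance : One (Double A γ)) with
    left_distrib := fun x y z => by
      ext <;> simp [mul_add, add_mul] <;> abel
    right_distrib := fun x y z => by
      ext <;> simp [mul_add, add_mul] <;> abel
    zero_mul := fun x => by ext <;> simp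
    mul_zero := fun x => by ext <;> simp
    one_mul := fun x => by ext <;> simp
    mul_one := fun x => by ext <;> simp [A.conj_one] }

instance : IsScalarTower K (Double A γ) (Double A γ) :=
  ⟨fun c x y => by
    ext
    · simp [smul_add, smul_comm c γ, smul_mul_assoc, mul_smul_comm]
    · simp [smul_add, smul_mul_assoc, mul_smul_comm]⟩

instance : SMulCommClass K (Double A γ) (Double A γ) :=
  ⟨fun c x y => by
    ext
    · simp [smul_add, smul_comm c γ, smul_mul_assoc, mul_smul_comm]
    · simp [smul_add, smul_mul_assoc, mul_smul_comm]⟩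

end Double

namespace Double

variable {A : ScalarInvAlgebra K} {γ : K}

/-- The involution `conj (a₁, a₂) = (conj a₁, -a₂)` of the double. -/
def conjMap : Double A γ →ₗ[K] Double A γ where
  toFun x := (A.conj x.1, -x.2)
  map_add' x y := by
    apply Double.ext
    · exact map_add A.conj x.1 y.1
    · exact neg_add x.2 y.2
  map_smul' c x := by
    apply Double.ext
    · exact map_smul A.conj c x.1
    · exact (smul_neg c x.2).symm

@[simp] theorem conjMap_fst (x : Double A γ) : (conjMap x).1 = A.conj x.1 := rfl
@[simp] theorem conjMap_snd (x : Double A γ) : (conjMap x).2 = -x.2 := rfl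

/-- The trace `tr (a₁, a₂) = tr a₁` of the double. -/
def trMap : Double A γ →ₗ[K] K where
  toFun x := A.tr x.1
  map_add' x y := map_add A.tr x.1 y.1
  map_smul' c x := map_smul A.tr c x.1

@[simp] theorem trMap_apply (x : Double A γ) : trMap x = A.tr x.1 := rfl

end Double

/-- The algebra `(A, γ)` obtained from `A` by the Cayley–Dickson process, with the involution
`conj (a₁, a₂) = (conj a₁, -a₂)`, trace `tr a₁` and norm `nrm a₁ - γ nrm a₂`. -/
def double (A : ScalarInvAlgebra K) (γ : K) : ScalarInvAlgebra K where
  carrier := Double A γ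
  conj := Double.conjMap
  tr := Double.trMap
  nrm x := A.nrm x.1 - γ * A.nrm x.2
  conj_conj x := by
    ext <;> simp [A.conj_conj]
  conj_mul x y := by
    ext
    · simp [A.conj_mul, A.conj_conj]
    · simp [A.conj_conj, add_comm]
  add_conj x := by
    ext
    · simp [A.add_conj]
    · simp
  mul_conj x := by
    ext
    · simp only [Double.mul_fst, Double.conjMap_fst, Double.conjMap_snd, Double.smul_fst,
        Double.one_fst, A.mul_conj, map_neg, neg_mul, A.conj_mul_self, smul_neg]
      rw [sub_smul, mul_smul, sub_eq_add_neg]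
    · simp [A.conj_conj]

/-- The algebra `K{α₁, …, α_t}`: starting from `K`, the Cayley–Dickson process is applied `t`
times, successively with the parameters `α₁, …, α_t`. -/
def cayleyDickson (K : Type u) [Field K] : (t : ℕ) → (Fin t → K) → ScalarInvAlgebra K
  | 0, _ => base K
  | t + 1, α => (cayleyDickson K t (fun i => α i.castSucc)).double (α (Fin.last t))

theorem finrank_cayleyDickson (t : ℕ) (α : Fin t → K) :
    Module.finrank K (cayleyDickson K t α).carrier = 2 ^ t := by
  induction t with
  | zero => exact Module.finrank_self K
  | succ t ih =>
    let A := cayleyDickson K t (fun i => α i.castSucc)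
    have h : Module.finrank K (A.carrier × A.carrier) = 2 ^ (t + 1) := by
      rw [Module.finrank_prod, ih, pow_succ, mul_two]
    exact h

/-- The trace form `T_C(x) = tr(x²) / 2`, i.e. the scalar part of `x²` when `2 ≠ 0`. -/
def traceForm (A : ScalarInvAlgebra K) : QuadraticForm K A.carrier :=
  LinearMap.BilinMap.toQuadraticMap
    ((2⁻¹ : K) • (LinearMap.mul K A.carrier).compr₂ A.tr)

theorem traceForm_apply (A : ScalarInvAlgebra K) (x : A.carrier) :
    A.traceForm x = 2⁻¹ * A.tr (x * x) := by
  simp [traceForm]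

/-- The subspace `A₀` of pure elements: those of trace zero, i.e. with `conj x = -x`. -/
def pureSubspace (A : ScalarInvAlgebra K) : Submodule K A.carrier := LinearMap.ker A.tr

/-- The pure trace form `T_P`, the restriction of `T_C` to the pure elements. -/
def pureTraceForm (A : ScalarInvAlgebra K) : QuadraticForm K A.pureSubspace :=
  A.traceForm.comp A.pureSubspace.subtype

end ScalarInvAlgebra

/-- The level `s(A)`: the least `n` such that `-1` is a sum of `n` squares in `A`
(and `⊤` if there is none). -/
noncomputable def algLevel (A : Type u) [NonAssocRing A] : ℕ∞ :=
  sInf {m : ℕ∞ | ∃ n : ℕ, m = n ∧ ∃ y : Fin n → A, ∑ i, y i * y i = -1}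

namespace QuadraticForm

variable {K : Type u} [Field K] {V : Type u} [AddCommGroup V] [Module K V]

/-- The `n`-fold orthogonal sum `n × Q = Q ⊥ … ⊥ Q`. -/
def copies (n : ℕ) (Q : QuadraticForm K V) : QuadraticForm K (Fin n → V) :=
  QuadraticMap.pi fun _ => Q

/-- `Q` is isotropic: it vanishes at some nonzero vector. -/
def IsIsotropic (Q : QuadraticForm K V) : Prop := ∃ v : V, v ≠ 0 ∧ Q v = 0

end QuadraticForm

/-! Put n = 2^k and Q = T_P. Writing y_i = a_i + p_i with a_i scalar and p_i pure, ∑ y_i² = -1 means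
∑ a_i p_i = 0 and ∑ a_i² + ∑ Q(p_i) = -1. Pfister's matrices M, with row `i₀` equal to a and M Mᵀ =
Mᵀ M = c for c = a·a, trade the relation ∑ a_i p_i = 0 for the loss of one vector. Given (a, p) with
a ≠ 0, the vectors Mp have `i₀` entry 0 and Q-sum c ∑ Q(p_i), so c² + c + c ∑ Q(p_i) = 0 is an
isotropy relation. If a = 0, a dimension count using dim A₀ = 2^t - 1 < n replaces this
(`exists_sum_sq_add_eq_zero_of_sum_eq_neg_one`). Conversely, from d² + a·a + ∑ Q(q_i) = 0 with c ≠
0, insert 0 at `i₀` and apply Mᵀ: the result is orthogonal to a, and rescaling gives -1. The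
degenerate cases use that an isotropic nondegenerate form represents -1. -/

open Matrix in
/-- `ι` indexes a sum of squares that is multiplicative in Pfister's sense: each vector `a` is the
row with index `i₀` of a matrix of similitude factor `∑ i, a i * a i`. -/
def HasSimilitudeRow (K : Type*) [Field K] (ι : Type*) [Fintype ι] [DecidableEq ι] (i₀ : ι) :
    Prop :=
  ∀ a : ι → K, ∃ M : Matrix ι ι K, M i₀ = a ∧
    M * Mᵀ = (a ⬝ᵥ a) • (1 : Matrix ι ι K) ∧ Mᵀ * M = (a ⬝ᵥ a) • (1 : Matrix ι ι K)

/-! ### Pfister's similitude matrices for sums of 2^k squares. -/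

section Pfister

open Matrix

variable {K : Type*} [Field K] {ι κ : Type*} [Fintype ι] [DecidableEq ι] [Fintype κ]
  [DecidableEq κ]

theorem transpose_mul_self_of_mul_transpose_self {M : Matrix ι ι K} {c : K} (hc : c ≠ 0)
    (h : M * Mᵀ = c • (1 : Matrix ι ι K)) : Mᵀ * M = c • (1 : Matrix ι ι K) := by
  have h1 : M * (c⁻¹ • Mᵀ) = 1 := by rw [Matrix.mul_smul, h, smul_smul, inv_mul_cancel₀ hc, one_smul]
  have h2 : (c⁻¹ • Mᵀ) * M = 1 := mul_eq_one_comm.mp h1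
  rw [← h2, Matrix.smul_mul, smul_smul, mul_inv_cancel₀ hc, one_smul]

theorem exists_similitudeRow_of_dotProduct_eq_zero (i₀ : ι) {a : ι → K} (ha : a ⬝ᵥ a = 0) :
    ∃ M : Matrix ι ι K, M i₀ = a ∧ M * Mᵀ = 0 ∧ Mᵀ * M = 0 := by
  by_cases h0 : a = 0
  · exact ⟨0, by rw [h0]; rfl, by simp, by simp⟩
  obtain ⟨s, hs⟩ := Function.ne_iff.mp h0
  -- A permuted multiple of a, hence isotropic, with entry 1 at `i₀`: the rank-one matrix v aᵀ then
  -- has row a there.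
  let v : ι → K := fun i => (a s)⁻¹ * a (Equiv.swap i₀ s i)
  have hv : v ⬝ᵥ v = 0 := by
    have : v ⬝ᵥ v = (a s)⁻¹ * (a s)⁻¹ * ∑ i, a (Equiv.swap i₀ s i) * a (Equiv.swap i₀ s i) := by
      simp only [v, dotProduct, Finset.mul_sum]
      exact Finset.sum_congr rfl fun i _ => by ring
    rw [this, Equiv.sum_comp (Equiv.swap i₀ s) fun i => a i * a i]
    change _ * (a ⬝ᵥ a) = 0
    rw [ha, mul_zero]
  refine ⟨vecMulVec v a, ?_, ?_, ?_⟩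
  · funext j
    have hs' : a s ≠ 0 := hs
    simp [vecMulVec_apply, v, hs']
  · rw [transpose_vecMulVec, vecMulVec_mul_vecMulVec, ha]; simp
  · rw [transpose_vecMulVec, vecMulVec_mul_vecMulVec, hv]; simp

/-- Complete the block row (A B) to a similitude by (X Y). One of c, d is nonzero, and its block is
the one inverted. The other may be a nonzero singular matrix of factor 0, which is why both products
M Mᵀ and Mᵀ M are carried along. -/
theorem HasSimilitudeRow.sum {i₀ : ι} (h : HasSimilitudeRow K ι i₀) :
    HasSimilitudeRow K (ι ⊕ ι) (Sum.inl i₀) := by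
  intro a
  by_cases hc : a ⬝ᵥ a = 0
  · obtain ⟨M, h1, h2, h3⟩ := exists_similitudeRow_of_dotProduct_eq_zero (Sum.inl i₀) hc
    exact ⟨M, h1, by rw [h2, hc, zero_smul], by rw [h3, hc, zero_smul]⟩
  obtain ⟨A, hA, hA1, hA2⟩ := h (a ∘ Sum.inl)
  obtain ⟨B, hB, hB1, hB2⟩ := h (a ∘ Sum.inr)
  have hsum : a ⬝ᵥ a =
      (a ∘ Sum.inl) ⬝ᵥ (a ∘ Sum.inl) + (a ∘ Sum.inr) ⬝ᵥ (a ∘ Sum.inr) := by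
    simp [dotProduct]
  set c := (a ∘ Sum.inl) ⬝ᵥ (a ∘ Sum.inl)
  set d := (a ∘ Sum.inr) ⬝ᵥ (a ∘ Sum.inr)
  suffices H : ∃ X Y : Matrix ι ι K, A * Xᵀ + B * Yᵀ = 0 ∧
      X * Xᵀ + Y * Yᵀ = (c + d) • (1 : Matrix ι ι K) by
    obtain ⟨X, Y, h1, h2⟩ := H
    have h3 : X * Aᵀ + Y * Bᵀ = 0 := by
      have := congrArg transpose h1
      simpa [transpose_add, transpose_mul] using this
    have hM : fromBlocks A B X Y * (fromBlocks A B X Y)ᵀ =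
        (a ⬝ᵥ a) • (1 : Matrix (ι ⊕ ι) (ι ⊕ ι) K) := by
      rw [fromBlocks_transpose, fromBlocks_multiply, h1, h2, h3, hA1, hB1, ← add_smul, hsum,
        ← fromBlocks_one, fromBlocks_smul]
      simp
    refine ⟨fromBlocks A B X Y, ?_, hM, transpose_mul_self_of_mul_transpose_self hc hM⟩
    funext j
    rcases j with j | j
    · exact congrFun hA j
    · exact congrFun hB j
  by_cases hc0 : c = 0
  · have hd : d ≠ 0 := by rintro hd; exact hc (by rw [hsum, hc0, hd, add_zero])
    refine ⟨Bᵀ, -(d⁻¹ • (Bᵀ * Aᵀ * B)), ?_, ?_⟩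
    · have : B * (Bᵀ * (A * B)) = d • (A * B) := by
        rw [← Matrix.mul_assoc, hB1, Matrix.smul_mul, Matrix.one_mul]
      simp [transpose_mul, this, smul_smul, hd]
    · have : Bᵀ * (Aᵀ * (B * (Bᵀ * (A * B)))) = (d * c * d) • (1 : Matrix ι ι K) := by
        rw [← Matrix.mul_assoc B, hB1, Matrix.smul_mul, Matrix.one_mul, Matrix.mul_smul,
          ← Matrix.mul_assoc Aᵀ, hA2, Matrix.smul_mul, Matrix.one_mul, Matrix.mul_smul,
          Matrix.mul_smul, hB2, smul_smul, smul_smul, mul_assoc]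
      simp [transpose_mul, Matrix.mul_assoc, this, hB2, hc0]
  · refine ⟨-(c⁻¹ • (Aᵀ * Bᵀ * A)), Aᵀ, ?_, ?_⟩
    · have : A * (Aᵀ * (B * A)) = c • (B * A) := by
        rw [← Matrix.mul_assoc, hA1, Matrix.smul_mul, Matrix.one_mul]
      simp [transpose_mul, this, smul_smul, hc0]
    · have : Aᵀ * (Bᵀ * (A * (Aᵀ * (B * A)))) = (c * d * c) • (1 : Matrix ι ι K) := by
        rw [← Matrix.mul_assoc A, hA1, Matrix.smul_mul, Matrix.one_mul, Matrix.mul_smul,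
          ← Matrix.mul_assoc Bᵀ, hB2, Matrix.smul_mul, Matrix.one_mul, Matrix.mul_smul,
          Matrix.mul_smul, hA2, smul_smul, smul_smul, mul_assoc]
      have h2 : c⁻¹ * (c⁻¹ * (c * d * c)) = d := by field_simp
      simp [transpose_mul, Matrix.mul_assoc, this, hA2, smul_smul, h2, ← add_smul, add_comm]

theorem HasSimilitudeRow.congr {i₀ : ι} (h : HasSimilitudeRow K ι i₀) (e : ι ≃ κ) :
    HasSimilitudeRow K κ (e i₀) := by
  intro a
  obtain ⟨M, h1, h2, h3⟩ := h (a ∘ e)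
  have hd : (a ∘ e) ⬝ᵥ (a ∘ e) = a ⬝ᵥ a := Equiv.sum_comp e fun i => a i * a i
  rw [hd] at h2 h3
  refine ⟨M.submatrix e.symm e.symm, ?_, ?_, ?_⟩
  · funext j
    simp [h1]
  · rw [transpose_submatrix, submatrix_mul_equiv, h2]
    ext i j; simp [one_apply]
  · rw [transpose_submatrix, submatrix_mul_equiv, h3]
    ext i j; simp [one_apply]

variable (K) in
/-- Pfister: sums of `2 ^ k` squares are multiplicative. -/
theorem exists_hasSimilitudeRow_two_pow (k : ℕ) :
    ∃ i₀ : Fin (2 ^ k), HasSimilitudeRow K (Fin (2 ^ k)) i₀ := by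
  induction k with
  | zero =>
    suffices H : HasSimilitudeRow K (Fin 1) 0 from ⟨_, H⟩
    refine fun a => ⟨of fun _ => a, rfl, ?_, ?_⟩ <;>
    · ext i j
      obtain rfl : i = 0 := Subsingleton.elim _ _
      obtain rfl : j = 0 := Subsingleton.elim _ _
      simp [mul_apply, dotProduct]
  | succ k ih =>
    obtain ⟨i₀, h⟩ := ih
    exact ⟨_, h.sum.congr (finSumFinEquiv.trans (finCongr (by ring)))⟩

/-- A similitude M of the sum of squares acts on tuples of vectors as M ⊗ 1, hence as a similitude
of the same factor for the orthogonal sum of copies of any form. -/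
theorem sum_quadraticForm_matrix {V : Type*} [AddCommGroup V] [Module K V]
    (B : V →ₗ[K] V →ₗ[K] K) {M : Matrix ι ι K} {c : K}
    (h : Mᵀ * M = c • (1 : Matrix ι ι K)) (p : ι → V) :
    ∑ i, B (∑ j, M i j • p j) (∑ j, M i j • p j) = c * ∑ i, B (p i) (p i) := by
  have h1 : ∀ i, B (∑ j, M i j • p j) (∑ j, M i j • p j) =
      ∑ j, ∑ l, M i j * M i l * B (p j) (p l) := fun i => by
    simp only [map_sum, LinearMap.sum_apply, map_smul, LinearMap.smul_apply, smul_eq_mul,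
      Finset.mul_sum]
    rw [Finset.sum_comm]
    exact Finset.sum_congr rfl fun j _ => Finset.sum_congr rfl fun l _ => by ring
  simp only [h1]
  rw [Finset.sum_comm, Finset.mul_sum]
  refine Finset.sum_congr rfl fun j _ => ?_
  rw [Finset.sum_comm]
  have h2 : ∀ l, ∑ i, M i j * M i l * B (p j) (p l) =
      (c • (1 : Matrix ι ι K)) j l * B (p j) (p l) := fun l => by
    rw [← h, mul_apply, Finset.sum_mul]
    rfl
  simp [h2, one_apply]

end Pfister

/-! ### Passing between the equation for -1 and isotropy. -/

section Isotropy

open Matrix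

variable {K : Type*} [Field K] {V : Type*} [AddCommGroup V] [Module K V]

theorem exists_sum_sq_add_eq_zero_of_sum_eq_neg_one [FiniteDimensional K V] (h2 : (2 : K) ≠ 0)
    (Q : QuadraticForm K V) {m : ℕ} {i₀ : Fin (m + 1)}
    (hM : HasSimilitudeRow K (Fin (m + 1)) i₀) {p : Fin (m + 1) → V}
    (hV : Module.finrank K V < m + 1) (hp : ∑ i, Q (p i) = -1) :
    ∃ (b : Fin (m + 1) → K) (q : Fin m → V), b ≠ 0 ∧ ∑ i, b i * b i + ∑ i, Q (q i) = 0 := by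
  have : Invertible (2 : K) := invertibleOfNonzero h2
  obtain ⟨w, ⟨e⟩⟩ := Q.equivalent_weightedSumSquares
  have hQ : ∀ f : Fin (Module.finrank K V) → K, Q (e.symm f) = ∑ j, w j * (f j * f j) :=
    fun f => by
      rw [e.symm.map_app, QuadraticMap.weightedSumSquares_apply]; rfl
  -- After diagonalisation each coordinate j gets its own similitude, built from the j-th
  -- coordinates of the p_i.
  choose M _ _ hMM using fun j => hM fun i => e (p i) j
  let L : (Fin (m + 1) → K) →ₗ[K] (Fin (Module.finrank K V) → K) :=
    LinearMap.pi fun j => (LinearMap.proj i₀).comp (M j).mulVecLin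
  -- There are dim V linear conditions on m + 1 > dim V unknowns. They kill the `i₀` entry of every
  -- M_j y, so only m vectors remain.
  obtain ⟨y, hy, hy0⟩ : ∃ y ∈ LinearMap.ker L, y ≠ 0 := by
    refine Submodule.exists_mem_ne_zero_of_ne_bot (LinearMap.ker_ne_bot_of_finrank_lt ?_)
    simpa using hV
  have hy' : ∀ j, (M j *ᵥ y) i₀ = 0 := fun j => congrFun (LinearMap.mem_ker.mp hy) j
  refine ⟨y, fun i => e.symm fun j => (M j *ᵥ y) (i₀.succAbove i), hy0, ?_⟩
  have h0 : ∑ i, Q (e.symm fun j => (M j *ᵥ y) (i₀.succAbove i)) =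
      ∑ i, Q (e.symm fun j => (M j *ᵥ y) i) := by
    rw [Fin.sum_univ_succAbove _ i₀, hQ fun j => (M j *ᵥ y) i₀]
    simp [hy']
  have h1 : ∀ j, (M j *ᵥ y) ⬝ᵥ (M j *ᵥ y) =
      ((fun i => e (p i) j) ⬝ᵥ fun i => e (p i) j) * (y ⬝ᵥ y) := fun j => by
    rw [dotProduct_mulVec, vecMul_mulVec, ← dotProduct_mulVec, hMM j]
    simp [smul_mulVec]
  rw [h0]
  simp only [hQ]
  rw [Finset.sum_comm]
  simp only [← Finset.mul_sum]
  change y ⬝ᵥ y + ∑ j, w j * ((M j *ᵥ y) ⬝ᵥ (M j *ᵥ y)) = 0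
  simp only [h1]
  have h3 : ∑ j, w j * ((fun i => e (p i) j) ⬝ᵥ fun i => e (p i) j) = -1 := by
    rw [← hp]
    have : ∀ i, Q (p i) = ∑ j, w j * (e (p i) j * e (p i) j) := fun i => by
      rw [← hQ]; simp
    simp only [this, dotProduct, Finset.mul_sum]
    exact Finset.sum_comm
  simp only [← mul_assoc, ← Finset.sum_mul, h3]
  ring

theorem exists_sum_sq_eq_neg_one_of_dotProduct_eq_zero {ι : Type*} [Fintype ι]
    [DecidableEq ι] {a : ι → K} (ha : a ≠ 0) (h : a ⬝ᵥ a = 0) : ∃ y : ι → K, y ⬝ᵥ y = -1 := by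
  obtain ⟨s, hs⟩ := Function.ne_iff.mp ha
  have hs' : a s ≠ 0 := hs
  -- With a isotropic, the square of r a + e_s is 2 r a_s + 1, which is -1 for r = -1/a_s.
  refine ⟨(-(a s)⁻¹) • a + Pi.single s 1, ?_⟩
  simp [h, hs']

theorem QuadraticForm.exists_sum_sq_add_eq_zero [FiniteDimensional K V] (h2 : (2 : K) ≠ 0)
    (Q : QuadraticForm K V) {m : ℕ} {i₀ : Fin (m + 1)}
    (hM : HasSimilitudeRow K (Fin (m + 1)) i₀) (hV : Module.finrank K V < m + 1)
    {a : Fin (m + 1) → K} {p : Fin (m + 1) → V} (hap : ∑ i, a i • p i = 0)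
    (h : ∑ i, a i * a i + ∑ i, Q (p i) = -1) :
    ∃ (b : Fin (m + 2) → K) (q : Fin m → V), b ≠ 0 ∧ ∑ i, b i * b i + ∑ i, Q (q i) = 0 := by
  suffices H : ∃ (d : K) (b : Fin (m + 1) → K) (q : Fin m → V), b ≠ 0 ∧
      d * d + ∑ i, b i * b i + ∑ i, Q (q i) = 0 by
    obtain ⟨d, b, q, hb, hq⟩ := H
    refine ⟨Fin.cons d b, q, fun h0 => hb ?_, ?_⟩
    · funext i
      simpa using congrFun h0 i.succ
    · rw [Fin.sum_univ_succ]
      simpa using hq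
  by_cases ha : a = 0
  · subst ha
    obtain ⟨b, q, hb, hq⟩ :=
      exists_sum_sq_add_eq_zero_of_sum_eq_neg_one h2 Q hM hV (p := p) (by simpa using h)
    exact ⟨0, b, q, hb, by simpa using hq⟩
  -- With c = a·a, the equation c + ∑ Q(p_i) = -1 times c reads c² + c + c ∑ Q(p_i) = 0, so the
  -- extra square is c².
  refine ⟨a ⬝ᵥ a, a, ?_⟩
  obtain ⟨M, hMa, -, hMM⟩ := hM a
  have : Invertible (2 : K) := invertibleOfNonzero h2
  have hB : ∀ x, Q x = QuadraticMap.associated (R := K) Q x x := fun x =>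
    (QuadraticMap.associated_eq_self_apply K Q x).symm
  have key := sum_quadraticForm_matrix (QuadraticMap.associated (R := K) Q) hMM p
  simp only [← hB] at key
  rw [Fin.sum_univ_succAbove _ i₀, hMa, hap, map_zero, zero_add] at key
  refine ⟨fun i => ∑ j, M (i₀.succAbove i) j • p j, ha, ?_⟩
  rw [key]
  change _ + a ⬝ᵥ a + _ = _
  change a ⬝ᵥ a + _ = _ at h
  linear_combination (a ⬝ᵥ a) * h

theorem QuadraticForm.exists_sum_sq_add_eq_neg_one (h2 : (2 : K) ≠ 0) (Q : QuadraticForm K V)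
    (hQ : ∀ v : V, v ≠ 0 → ∃ w, QuadraticMap.polar Q v w ≠ 0) {m : ℕ} {i₀ : Fin (m + 1)}
    (hM : HasSimilitudeRow K (Fin (m + 1)) i₀) {b : Fin (m + 2) → K} {q : Fin m → V}
    (hbq : b ≠ 0 ∨ q ≠ 0) (h : ∑ i, b i * b i + ∑ i, Q (q i) = 0) :
    ∃ (a : Fin (m + 1) → K) (p : Fin (m + 1) → V), ∑ i, a i • p i = 0 ∧
      ∑ i, a i * a i + ∑ i, Q (p i) = -1 := by
  have hpure : (∃ p : Fin m → V, ∑ i, Q (p i) = -1) →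
      ∃ (a : Fin (m + 1) → K) (p : Fin (m + 1) → V), ∑ i, a i • p i = 0 ∧
      ∑ i, a i * a i + ∑ i, Q (p i) = -1 := by
    rintro ⟨p, hp⟩
    exact ⟨0, Fin.cons 0 p, by simp, by simp [Fin.sum_univ_succ, hp]⟩
  rw [Fin.sum_univ_succ] at h
  set d := b 0
  set a : Fin (m + 1) → K := fun i => b i.succ
  by_cases ha : a = 0
  · have h' : d * d + ∑ i, Q (q i) = 0 := by
      have : ∀ i : Fin (m + 1), b i.succ = 0 := fun i => congrFun ha i
      simpa [this] using h
    refine hpure ?_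
    by_cases hd : d = 0
    · have hq : q ≠ 0 := by
        refine hbq.resolve_left fun hb => hb ?_
        funext i
        exact Fin.cases hd (fun j => congrFun ha j) i
      obtain ⟨s, hs⟩ := Function.ne_iff.mp hq
      obtain ⟨w, hw⟩ := hQ (q s) hs
      have hq0 : ∑ i, Q (q i) = 0 := by simpa [hd] using h'
      set c := QuadraticMap.polar Q (q s) w
      let r : K := (-1 - Q w) * c⁻¹
      let x : Fin m → V := r • q + Pi.single s w
      -- The tuple q is isotropic and pairs with w, placed in slot s, to c ≠ 0. The value at r q + w
      -- is Q(w) + r c, and r was solved from setting this to -1.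
      refine ⟨x, ?_⟩
      have h1 : ∀ i, Q (x i) =
          r * r * Q (q i) + if i = s then Q w + r * c else 0 := fun i => by
        by_cases hi : i = s
        · subst hi
          simp [x, QuadraticMap.map_add Q, QuadraticMap.map_smul, QuadraticMap.polar_smul_left, c,
            add_assoc]
        · simp [x, hi, QuadraticMap.map_smul]
      simp only [h1, Finset.sum_add_distrib, ← Finset.mul_sum, hq0]
      simp [r, hw]
    · refine ⟨fun i => d⁻¹ • q i, ?_⟩
      simp only [QuadraticMap.map_smul, smul_eq_mul, ← Finset.mul_sum]
      rw [eq_neg_of_add_eq_zero_right h']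
      field_simp
  by_cases hc : a ⬝ᵥ a = 0
  · obtain ⟨y, hy⟩ := exists_sum_sq_eq_neg_one_of_dotProduct_eq_zero ha hc
    exact ⟨y, 0, by simp, by simpa [dotProduct] using hy⟩
  obtain ⟨M, hMa, hMM, -⟩ := hM a
  have : Invertible (2 : K) := invertibleOfNonzero h2
  have hB : ∀ x, Q x = QuadraticMap.associated (R := K) Q x x := fun x =>
    (QuadraticMap.associated_eq_self_apply K Q x).symm
  let p : Fin (m + 1) → V := i₀.insertNth 0 q
  have key := sum_quadraticForm_matrix (QuadraticMap.associated (R := K) Q) (M := Mᵀ)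
    (by simpa using hMM) p
  simp only [← hB] at key
  have hp : ∑ i, Q (p i) = ∑ i, Q (q i) := by
    rw [Fin.sum_univ_succAbove _ i₀]; simp [p]
  -- Pairing Mᵀp with a gives the `i₀` entry of M Mᵀ p = c p, which is 0 by the choice of p.
  have horth : ∑ i, a i • ∑ j, Mᵀ i j • p j = 0 := by
    simp only [Finset.smul_sum, smul_smul]
    rw [Finset.sum_comm]
    simp only [← Finset.sum_smul]
    refine Finset.sum_eq_zero fun j _ => ?_
    have h3 : ∑ i, a i * Mᵀ i j = (M * Mᵀ) i₀ j := by
      rw [mul_apply, hMa]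
    rw [h3, hMM]
    by_cases hj : i₀ = j
    · subst hj; simp [p]
    · simp [one_apply, hj]
  set c := a ⬝ᵥ a with hcdef
  -- The two sums become d²/c and (1/c) ∑ Q(q_i) = -(d² + c)/c, with total -1.
  refine ⟨fun i => c⁻¹ * d * a i, fun i => c⁻¹ • ∑ j, Mᵀ i j • p j, ?_, ?_⟩
  · have : ∀ i, (c⁻¹ * d * a i) • c⁻¹ • ∑ j, Mᵀ i j • p j =
        (c⁻¹ * d * c⁻¹) • a i • ∑ j, Mᵀ i j • p j := fun i => by
      simp only [smul_smul]; congr 1; ring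
    simp only [this, ← Finset.smul_sum, horth, smul_zero]
  · simp only [QuadraticMap.map_smul, smul_eq_mul, ← Finset.mul_sum, key, hp]
    have h4 : ∑ i, c⁻¹ * d * a i * (c⁻¹ * d * a i) = c⁻¹ * d * (c⁻¹ * d) * c := by
      rw [hcdef, dotProduct, Finset.mul_sum]
      exact Finset.sum_congr rfl fun i _ => by ring
    rw [h4]
    have h5 : d * d + c + ∑ i, Q (q i) = 0 := by rw [add_assoc] at h ⊢; exact h
    have h6 : ∑ i, Q (q i) = -(d * d + c) := by linear_combination h5
    rw [h6]
    field_simp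
    ring

end Isotropy

/-! ### Scalar and pure parts; nondegeneracy of the trace forms. -/

namespace ScalarInvAlgebra

variable {K : Type u} [Field K]

theorem tr_one (A : ScalarInvAlgebra K) : A.tr 1 = 2 := by
  have h := A.add_conj 1
  rw [A.conj_one, ← two_smul K] at h
  exact (smul_left_injective K (one_ne_zero (α := A.carrier)) h).symm

theorem tr_conj (A : ScalarInvAlgebra K) (x : A.carrier) : A.tr (A.conj x) = A.tr x := by
  have h := A.add_conj (A.conj x)
  rw [A.conj_conj, add_comm, A.add_conj] at h
  exact (smul_left_injective K (one_ne_zero (α := A.carrier)) h).symm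

theorem conj_of_mem_pureSubspace (A : ScalarInvAlgebra K) {x : A.carrier}
    (hx : x ∈ A.pureSubspace) : A.conj x = -x := by
  rw [A.conj_eq, LinearMap.mem_ker.mp hx, zero_smul, zero_sub]

theorem mul_self_of_mem_pureSubspace (A : ScalarInvAlgebra K) (h2 : (2 : K) ≠ 0) {x : A.carrier}
    (hx : x ∈ A.pureSubspace) : x * x = A.traceForm x • (1 : A.carrier) := by
  have h := A.mul_conj x
  rw [A.conj_of_mem_pureSubspace hx, mul_neg] at h
  have h' : x * x = (-A.nrm x) • (1 : A.carrier) := by rw [neg_smul, ← h, neg_neg]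
  rw [A.traceForm_apply, h', map_smul, A.tr_one, smul_eq_mul]
  congr 1
  field_simp

theorem tr_mul_comm_of_mem_pureSubspace (A : ScalarInvAlgebra K) {x y : A.carrier}
    (hx : x ∈ A.pureSubspace) (hy : y ∈ A.pureSubspace) : A.tr (x * y) = A.tr (y * x) := by
  rw [← A.tr_conj, A.conj_mul, A.conj_of_mem_pureSubspace hx, A.conj_of_mem_pureSubspace hy,
    neg_mul_neg]

theorem smul_one_add_mul_self (A : ScalarInvAlgebra K) (h2 : (2 : K) ≠ 0) (a : K)
    (p : A.pureSubspace) :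
    (a • (1 : A.carrier) + p) * (a • (1 : A.carrier) + p) =
      (a * a + A.pureTraceForm p) • (1 : A.carrier) + (2 : K) • ((a • p : A.pureSubspace) : A.carrier) := by
  have h : A.pureTraceForm p = A.traceForm p := rfl
  rw [h, add_smul, ← A.mul_self_of_mem_pureSubspace h2 p.2, Submodule.coe_smul, two_smul]
  simp only [mul_add, add_mul, smul_mul_assoc, mul_smul_comm, one_mul, mul_one, smul_add, smul_smul]
  abel

theorem exists_smul_one_add (A : ScalarInvAlgebra K) (h2 : (2 : K) ≠ 0) (x : A.carrier) :
    ∃ (a : K) (p : A.pureSubspace), x = a • (1 : A.carrier) + p := by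
  refine ⟨2⁻¹ * A.tr x, ⟨x - (2⁻¹ * A.tr x) • 1, LinearMap.mem_ker.mpr ?_⟩, by simp⟩
  rw [map_sub, map_smul, A.tr_one, smul_eq_mul]
  field_simp
  ring

theorem smul_one_add_eq_iff (A : ScalarInvAlgebra K) (h2 : (2 : K) ≠ 0) {a b : K}
    {p : A.pureSubspace} : a • (1 : A.carrier) + p = b • 1 ↔ p = 0 ∧ a = b := by
  constructor
  · intro h
    have h1 := congrArg A.tr h
    rw [map_add, map_smul, map_smul, A.tr_one, LinearMap.mem_ker.mp p.2, add_zero] at h1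
    have hab : a = b := mul_right_cancel₀ h2 h1
    subst hab
    exact ⟨Subtype.ext (by simpa using h), rfl⟩
  · rintro ⟨rfl, rfl⟩
    simp

/-- Pure elements have scalar squares, so the pure part of (a + p)² is 2 a p; scalar and pure parts
of the sum are compared separately. -/
theorem exists_sum_mul_self_eq_neg_one_iff (A : ScalarInvAlgebra K) (h2 : (2 : K) ≠ 0) {ι : Type*}
    [Fintype ι] : (∃ y : ι → A.carrier, ∑ i, y i * y i = -1) ↔
      ∃ (a : ι → K) (p : ι → A.pureSubspace), ∑ i, a i • p i = 0 ∧
        ∑ i, a i * a i + ∑ i, A.pureTraceForm (p i) = -1 := by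
  have key : ∀ (a : ι → K) (p : ι → A.pureSubspace),
      ∑ i, (a i • (1 : A.carrier) + p i) * (a i • (1 : A.carrier) + p i) = -1 ↔
      ∑ i, a i • p i = 0 ∧ ∑ i, a i * a i + ∑ i, A.pureTraceForm (p i) = -1 := by
    intro a p
    simp only [A.smul_one_add_mul_self h2]
    rw [Finset.sum_add_distrib, ← Finset.sum_smul, Finset.sum_add_distrib, ← Finset.smul_sum,
      ← AddSubmonoidClass.coe_finsetSum, ← Submodule.coe_smul,
      show (-1 : A.carrier) = (-1 : K) • 1 by simp, A.smul_one_add_eq_iff h2]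
    simp [h2]
  constructor
  · rintro ⟨y, hy⟩
    choose a p hap using fun i => A.exists_smul_one_add h2 (y i)
    exact ⟨a, p, (key a p).mp (by simpa only [← hap] using hy)⟩
  · rintro ⟨a, p, h⟩
    exact ⟨_, (key a p).mpr h⟩

theorem finrank_pureSubspace_add_one (A : ScalarInvAlgebra K) (h2 : (2 : K) ≠ 0) :
    Module.finrank K A.pureSubspace + 1 = Module.finrank K A.carrier := by
  have hs : Function.Surjective A.tr := LinearMap.surjective (f := A.tr) fun h => h2 (by
    rw [← A.tr_one, h, LinearMap.zero_apply])
  rw [← LinearMap.finrank_range_add_finrank_ker A.tr, LinearMap.range_eq_top.mpr hs, finrank_top,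
    Module.finrank_self, add_comm]
  rfl

/-- In a double, (x₁, x₂) is tested against (y, 0) if x₁ ≠ 0. Otherwise (0, y) gives γ tr(ȳ x₂) = γ
tr(x̄₂ y), where γ ≠ 0 is needed. -/
theorem exists_tr_mul_ne_zero (h2 : (2 : K) ≠ 0) (t : ℕ) (α : Fin t → K) (hα : ∀ i, α i ≠ 0)
    (x : (cayleyDickson K t α).carrier) (hx : x ≠ 0) :
    ∃ y, (cayleyDickson K t α).tr (x * y) ≠ 0 := by
  induction t with
  | zero =>
    refine ⟨1, ?_⟩
    rw [mul_one]
    exact mul_ne_zero h2 hx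
  | succ t ih =>
    have ih := ih (fun i => α i.castSucc) fun i => hα _
    let A := cayleyDickson K t (fun i => α i.castSucc)
    let x' : Double A (α (Fin.last t)) := x
    have htr : ∀ y : Double A (α (Fin.last t)), (A.double (α (Fin.last t))).tr (x' * y : Double A _) =
        A.tr (x'.1 * y.1) + α (Fin.last t) * A.tr (A.conj y.2 * x'.2) := fun y => by
      change A.tr (x'.1 * y.1 + α (Fin.last t) • (A.conj y.2 * x'.2)) = _
      rw [map_add, map_smul, smul_eq_mul]
    by_cases h1 : x'.1 = 0
    · have hx2 : x'.2 ≠ 0 := fun h => hx (Double.ext (x := x') (y := 0) h1 h)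
      have hc : A.conj x'.2 ≠ 0 := fun h => hx2 (by rw [← A.conj_conj x'.2, h, map_zero])
      obtain ⟨y, hy⟩ := ih _ hc
      refine ⟨((0, y) : A.carrier × A.carrier), ?_⟩
      refine (htr (0, y)).trans_ne ?_
      rw [h1, zero_mul, map_zero, zero_add, ← A.tr_conj, A.conj_mul, A.conj_conj]
      exact mul_ne_zero (hα _) hy
    · obtain ⟨y, hy⟩ := ih _ h1
      refine ⟨((y, 0) : A.carrier × A.carrier), ?_⟩
      refine (htr (y, 0)).trans_ne ?_
      simpa using hy

theorem exists_polar_pureTraceForm_ne_zero (A : ScalarInvAlgebra K) (h2 : (2 : K) ≠ 0)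
    (hA : ∀ x : A.carrier, x ≠ 0 → ∃ y, A.tr (x * y) ≠ 0) (p : A.pureSubspace) (hp : p ≠ 0) :
    ∃ q, QuadraticMap.polar A.pureTraceForm p q ≠ 0 := by
  obtain ⟨y, hy⟩ := hA p fun h => hp (Subtype.ext h)
  obtain ⟨a, q, rfl⟩ := A.exists_smul_one_add h2 y
  refine ⟨q, ?_⟩
  have h : ∀ r, A.pureTraceForm r = 2⁻¹ * A.tr (r * r) := fun r => A.traceForm_apply r
  rw [mul_add, map_add, mul_smul_comm, mul_one, map_smul, LinearMap.mem_ker.mp p.2, smul_zero,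
    zero_add] at hy
  -- The scalar part of y pairs to 0 with the pure p, so the pure part q already detects p.
  have : QuadraticMap.polar A.pureTraceForm p q = A.tr (p * q) := by
    simp only [QuadraticMap.polar, h, Submodule.coe_add, mul_add, add_mul, map_add,
      A.tr_mul_comm_of_mem_pureSubspace q.2 p.2]
    field_simp
    ring
  rwa [this]

end ScalarInvAlgebra

/-! ### The level and the final equivalence. -/

theorem algLevel_le_iff {A : Type u} [NonAssocRing A] (n : ℕ) :
    algLevel A ≤ n ↔ ∃ y : Fin n → A, ∑ i, y i * y i = -1 := by
  constructor
  · intro h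
    have hne : {m : ℕ∞ | ∃ n : ℕ, m = n ∧ ∃ y : Fin n → A, ∑ i, y i * y i = -1}.Nonempty := by
      by_contra hne
      rw [algLevel, Set.not_nonempty_iff_eq_empty.mp hne, sInf_empty] at h
      exact absurd h (by simp)
    obtain ⟨l, hl, y, hy⟩ := csInf_mem hne
    rw [algLevel, hl] at h
    obtain ⟨r, rfl⟩ := Nat.exists_eq_add_of_le (Nat.cast_le.mp h)
    -- A shorter sum of squares is padded with zeros.
    exact ⟨Fin.append y 0, by simp [Fin.sum_univ_add, hy]⟩
  · rintro ⟨y, hy⟩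
    exact sInf_le ⟨n, rfl, y, hy⟩

theorem QuadraticForm.isIsotropic_prod_copies_iff {K V : Type u} [Field K] [AddCommGroup V]
    [Module K V] (Q : QuadraticForm K V) (l m : ℕ) :
    IsIsotropic (QuadraticMap.prod (copies l (QuadraticMap.sq : QuadraticForm K K))
      (copies m Q)) ↔ ∃ (b : Fin l → K) (q : Fin m → V), (b ≠ 0 ∨ q ≠ 0) ∧
        ∑ i, b i * b i + ∑ i, Q (q i) = 0 := by
  simp only [IsIsotropic, copies, Prod.exists, QuadraticMap.prod_apply, QuadraticMap.pi_apply,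
    QuadraticMap.sq_apply, ne_eq, Prod.mk_eq_zero, not_and_or]

theorem proposition3p7 {K : Type u} [Field K] (hK : ringChar K ≠ 2) (t k : ℕ) (hkt : t ≤ k)
    (α : Fin t → K) (hα : ∀ i, α i ≠ 0) :
    algLevel (ScalarInvAlgebra.cayleyDickson K t α).carrier ≤ 2 ^ k ↔
      QuadraticForm.IsIsotropic
        (QuadraticMap.prod
          (QuadraticForm.copies (2 ^ k + 1) (QuadraticMap.sq : QuadraticForm K K))
          (QuadraticForm.copies (2 ^ k - 1)
            (ScalarInvAlgebra.cayleyDickson K t α).pureTraceForm)) := by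
  have h2 : (2 : K) ≠ 0 := Ring.two_ne_zero hK
  rw [QuadraticForm.isIsotropic_prod_copies_iff, show (2 : ℕ∞) ^ k = ((2 ^ k : ℕ) : ℕ∞) by simp,
    algLevel_le_iff, ScalarInvAlgebra.exists_sum_mul_self_eq_neg_one_iff _ h2]
  obtain ⟨i₀, hM⟩ := exists_hasSimilitudeRow_two_pow K k
  have hV : Module.finrank K (ScalarInvAlgebra.cayleyDickson K t α).pureSubspace < 2 ^ k := by
    have h1 := (ScalarInvAlgebra.cayleyDickson K t α).finrank_pureSubspace_add_one h2
    rw [ScalarInvAlgebra.finrank_cayleyDickson] at h1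
    have h3 : 2 ^ t ≤ 2 ^ k := Nat.pow_le_pow_right two_pos hkt
    omega
  obtain ⟨m, hm⟩ : ∃ m, 2 ^ k = m + 1 := Nat.exists_eq_add_one.mpr (by positivity)
  -- From here 2^k matters only through `hM` and `hV`; as m + 1 it turns the truncated 2^k - 1 into
  -- m.
  generalize 2 ^ k = n at *
  subst hm
  rw [Nat.add_sub_cancel]
  constructor
  · rintro ⟨a, p, hap, h⟩
    obtain ⟨b, q, hb, hq⟩ := QuadraticForm.exists_sum_sq_add_eq_zero h2 _ hM hV hap h
    exact ⟨b, q, Or.inl hb, hq⟩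
  · rintro ⟨b, q, hbq, h⟩
    exact QuadraticForm.exists_sum_sq_add_eq_neg_one h2 _
      (ScalarInvAlgebra.exists_polar_pureTraceForm_ne_zero _ h2
        (ScalarInvAlgebra.exists_tr_mul_ne_zero h2 t α hα)) hM hbq h
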